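/- Let $(M,\omega)$ be a (finite-dimensional, smooth) symplectic manifold. For a smooth function $g$ let $X_g$ be its Hamiltonian vector field, $\omega(X_g,\cdot)=dg$, and let $\{f,g\}=df(X_g)$ be the Poisson bracket. Let $f,g\in C^\infty(M)$ and put $$\Phi=-\{\{\{f,g\},f\},f\}-\{\{\{f,g\},g\},g\}:M\to\mathbb{R}.$$ Let $x\in M$ be a non-degenerate critical point of $\{f,g\}$, and let $U$ be a neighborhood of $x$ with compact closure such that $\{f,g\}(y)<\{f,g\}(x)$ for every $y\in\overline{U}\setminus\{x\}$. Then $\Phi(x)\ge 0$, and there is an open neighborhood $V$ of $x$ with $\overline{V}\subset U$ such that for all sufficiently small $\varepsilon>0$ there exist smooth functions $F,G:M\to\mathbb{R}$ with $F=f$ and $G=g$ on $M\setminus V$, $$\sup_M|F-f|\le\varepsilon,\qquad \sup_M|G-g|\le\varepsilon,$$ $$\{F,G\}(y)\le\{f,g\}(x)-\tfrac13\,\Phi(x)^{1/3}\,\varepsilon^{2/3}\qquad\text{for all }y\in U.$$ Moreover only one of the two functions is perturbed: one can take $G=g$ if $\{\{\{f,g\},g\},g\}(x)\le\{\{\{f,g\},f\},f\}(x)$,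 and $F=f$ otherwise. -/

import Mathlib

open scoped Manifold ContDiff Topology

noncomputable section

namespace SymplecticGeometry

variable {E : Type*} [NormedAddCommGroup E] [NormedSpace ℝ E]
  {M : Type*} [TopologicalSpace M] [ChartedSpace E M]

/-- A (not necessarily continuous) differential `2`-form on `M`: an alternating bilinear form on
every tangent space. -/
abbrev TwoForm (E : Type*) [NormedAddCommGroup E] [NormedSpace ℝ E]
    (M : Type*) [TopologicalSpace M] [ChartedSpace E M] : Type _ :=
  ∀ y : M, TangentSpace 𝓘(ℝ, E) y [⋀^Fin 2]→L[ℝ] ℝ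

/-- The expression of a `2`-form in the preferred chart at `p`: the pullback of the form under the
inverse of the chart. It is meaningful on the target of the chart. -/
def TwoForm.inChart (Ω : TwoForm E M) (p : M) : E → E [⋀^Fin 2]→L[ℝ] ℝ := fun u =>
  (Ω ((extChartAt 𝓘(ℝ, E) p).symm u)).compContinuousLinearMap
    (mfderiv 𝓘(ℝ, E) 𝓘(ℝ, E) (extChartAt 𝓘(ℝ, E) p).symm u)

/-- A symplectic form on `M`: a smooth, closed, non-degenerate `2`-form. Smoothness and closedness
are expressed in charts. -/
structure SymplecticForm (E : Type*) [NormedAddCommGroup E] [NormedSpace ℝ E]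
    (M : Type*) [TopologicalSpace M] [ChartedSpace E M] where
  /-- the underlying `2`-form -/
  form : TwoForm E M
  smooth : ∀ p : M, ContDiffOn ℝ ∞ (form.inChart p) (extChartAt 𝓘(ℝ, E) p).target
  closed : ∀ p : M, ∀ u ∈ (extChartAt 𝓘(ℝ, E) p).target, extDeriv (form.inChart p) u = 0
  nondegenerate : ∀ (y : M) (v : TangentSpace 𝓘(ℝ, E) y), (∀ w, form y ![v, w] = 0) → v = 0

variable [FiniteDimensional ℝ E]

/-- By non-degeneracy, every covector is the contraction of the symplectic form with a unique
tangent vector. -/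
theorem SymplecticForm.existsUnique_contraction (Ω : SymplecticForm E M) (y : M)
    (α : TangentSpace 𝓘(ℝ, E) y →L[ℝ] ℝ) :
    ∃! v : TangentSpace 𝓘(ℝ, E) y, ∀ w, Ω.form y ![v, w] = α w := by
  have : FiniteDimensional ℝ (TangentSpace 𝓘(ℝ, E) y) := inferInstanceAs (FiniteDimensional ℝ E)
  have e₀ : ∀ v w a : TangentSpace 𝓘(ℝ, E) y, Function.update ![v, w] 0 a = ![a, w] :=
    fun v w a => by funext i; fin_cases i <;> simp
  have e₁ : ∀ v w a : TangentSpace 𝓘(ℝ, E) y, Function.update ![v, w] 1 a = ![v, a] :=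
    fun v w a => by funext i; fin_cases i <;> simp
  let L : TangentSpace 𝓘(ℝ, E) y →ₗ[ℝ] Module.Dual ℝ (TangentSpace 𝓘(ℝ, E) y) :=
    LinearMap.mk₂ ℝ (fun v w => Ω.form y ![v, w])
      (fun v v' w => by
        have h := (Ω.form y).map_update_add ![v, w] 0 v v'
        rwa [e₀, e₀, e₀] at h)
      (fun c v w => by
        have h := (Ω.form y).map_update_smul ![v, w] 0 c v
        rwa [e₀, e₀] at h)
      (fun v w w' => by
        have h := (Ω.form y).map_update_add ![v, w] 1 w w'
        rwa [e₁, e₁, e₁] at h)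
      (fun c v w => by
        have h := (Ω.form y).map_update_smul ![v, w] 1 c w
        rwa [e₁, e₁] at h)
  have hL : Function.Injective L := by
    rw [injective_iff_map_eq_zero]
    intro v hv
    exact Ω.nondegenerate y v fun w => LinearMap.congr_fun hv w
  have hs : Function.Surjective L :=
    (LinearMap.injective_iff_surjective_of_finrank_eq_finrank
      (Subspace.dual_finrank_eq (K := ℝ)).symm).1 hL
  obtain ⟨v, hv⟩ := hs (α : TangentSpace 𝓘(ℝ, E) y →ₗ[ℝ] ℝ)
  refine ⟨v, fun w => LinearMap.congr_fun hv w, fun v' hv' => hL ?_⟩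
  rw [hv]
  exact LinearMap.ext hv'

/-- The Hamiltonian vector field `X_g` of `g : M → ℝ`: the vector field with
`Ω (X_g, ·) = dg`. -/
def SymplecticForm.hamiltonianVectorField (Ω : SymplecticForm E M) (g : M → ℝ) (y : M) :
    TangentSpace 𝓘(ℝ, E) y :=
  (Ω.existsUnique_contraction y (mfderiv 𝓘(ℝ, E) 𝓘(ℝ, ℝ) g y)).choose

/-- The Poisson bracket `{f, g} = df (X_g)`. -/
def SymplecticForm.poissonBracket (Ω : SymplecticForm E M) (f g : M → ℝ) : M → ℝ := fun y =>
  mfderiv 𝓘(ℝ, E) 𝓘(ℝ, ℝ) f y (Ω.hamiltonianVectorField g y)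

/-- The function `Φ = -{{{f, g}, f}, f} - {{{f, g}, g}, g}`. -/
def SymplecticForm.Phi (Ω : SymplecticForm E M) (f g : M → ℝ) : M → ℝ := fun y =>
  - Ω.poissonBracket (Ω.poissonBracket (Ω.poissonBracket f g) f) f y
    - Ω.poissonBracket (Ω.poissonBracket (Ω.poissonBracket f g) g) g y

end SymplecticGeometry

namespace SymplecticGeometry

/-- `x` is a non-degenerate critical point of `h`: in the preferred chart at `x`, the first
derivative of `h` vanishes at (the image of) `x` and the second derivative there is a
non-degenerate bilinear form. For smooth `h` this does not depend on the chart. -/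
def IsNondegenerateCriticalPoint (E : Type*) [NormedAddCommGroup E] [NormedSpace ℝ E]
    {M : Type*} [TopologicalSpace M] [ChartedSpace E M] (h : M → ℝ) (x : M) : Prop :=
  fderiv ℝ (h ∘ (extChartAt 𝓘(ℝ, E) x).symm) (extChartAt 𝓘(ℝ, E) x x) = 0 ∧
    ∀ v : E,
      (∀ w : E, fderiv ℝ (fderiv ℝ (h ∘ (extChartAt 𝓘(ℝ, E) x).symm))
        (extChartAt 𝓘(ℝ, E) x x) v w = 0) → v = 0

end SymplecticGeometry

end

/-! Write `h = {f,g}`. Replacing `f` by `f + u` adds `{u,g}` to `h`, and replacing `g` by `g - u`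
adds `{u,f}`; so for `k` equal to `g` or `f` the task is to lower the peak of `h` by `{u,k}` with
`u` small.

Let `B` be the Hessian of `h` at `x`, `w` the value `X_k(x)`, and `τ = {h,k}`. Then `dτ(x) = B(·,w)`
and `{τ,k}(x) = B(w,w) = -a` with `a ≥ 0`, which gives `Φ(x) ≥ 0`. Cauchy–Schwarz for `-B` shows
that `h(x) - h` is at least about `τ²/(2a)` near `x` (`eventually_sq_poissonBracket_le`).

Take `u = a s³ sin(τ/(a s))`, cut off near `x`. With `t = τ/(a s)`, `{u,k}` is about `-a s² cos t`,
while `h` already lies about `a s² t²/2` below its peak. As `t²/2 + cos t ≥ 1`, the sum stays about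
`a s²` below `h(x)`; half of this is kept to absorb errors (`exists_perturbation`). Away from `x`
the strict maximum leaves a gap that beats the `O(s²)` perturbation.

Finally `ε = a s³` gives `a s² = a^(1/3) ε^(2/3)`, and the `k` with the larger `a` has `Φ(x) ≤ 2a`.
-/

namespace SymplecticGeometry

/-! ### Algebra and smoothness of the Poisson bracket -/

section Brackets

variable {E : Type*} [NormedAddCommGroup E] [NormedSpace ℝ E] [FiniteDimensional ℝ E]
  {M : Type*} [TopologicalSpace M] [ChartedSpace E M] (Ω : SymplecticForm E M)

theorem SymplecticForm.form_hamiltonianVectorField (g : M → ℝ) (y : M)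
    (w : TangentSpace 𝓘(ℝ, E) y) :
    Ω.form y ![Ω.hamiltonianVectorField g y, w] = mfderiv 𝓘(ℝ, E) 𝓘(ℝ, ℝ) g y w :=
  (Ω.existsUnique_contraction y (mfderiv 𝓘(ℝ, E) 𝓘(ℝ, ℝ) g y)).choose_spec.1 w

theorem SymplecticForm.eq_hamiltonianVectorField {g : M → ℝ} {y : M}
    {v : TangentSpace 𝓘(ℝ, E) y}
    (hv : ∀ w, Ω.form y ![v, w] = mfderiv 𝓘(ℝ, E) 𝓘(ℝ, ℝ) g y w) :
    v = Ω.hamiltonianVectorField g y :=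
  (Ω.existsUnique_contraction y (mfderiv 𝓘(ℝ, E) 𝓘(ℝ, ℝ) g y)).choose_spec.2 v hv

theorem SymplecticForm.poissonBracket_swap (f g : M → ℝ) (y : M) :
    Ω.poissonBracket f g y = -Ω.poissonBracket g f y := by
  have h := (Ω.form y).map_swap ![Ω.hamiltonianVectorField f y, Ω.hamiltonianVectorField g y]
    (i := 0) (j := 1) (by decide)
  have e : (![Ω.hamiltonianVectorField f y, Ω.hamiltonianVectorField g y] ∘ Equiv.swap 0 1 :
      Fin 2 → TangentSpace 𝓘(ℝ, E) y) =
      ![Ω.hamiltonianVectorField g y, Ω.hamiltonianVectorField f y] := by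
    funext i; fin_cases i <;> simp
  rw [e] at h
  replace h : Ω.form y ![Ω.hamiltonianVectorField g y, Ω.hamiltonianVectorField f y] =
      -Ω.form y ![Ω.hamiltonianVectorField f y, Ω.hamiltonianVectorField g y] := h
  rw [Ω.form_hamiltonianVectorField, Ω.form_hamiltonianVectorField] at h
  exact neg_eq_iff_eq_neg.1 h.symm

theorem SymplecticForm.poissonBracket_eq_of_hasMFDerivAt {f : M → ℝ} {y : M}
    {f' : TangentSpace 𝓘(ℝ, E) y →L[ℝ] ℝ} (hf : HasMFDerivAt 𝓘(ℝ, E) 𝓘(ℝ, ℝ) f y f')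
    (g : M → ℝ) : Ω.poissonBracket f g y = f' (Ω.hamiltonianVectorField g y) := by
  unfold SymplecticForm.poissonBracket
  rw [hf.mfderiv]
  rfl

theorem SymplecticForm.poissonBracket_add_left {f f₁ : M → ℝ}
    (hf : MDifferentiable 𝓘(ℝ, E) 𝓘(ℝ, ℝ) f) (hf₁ : MDifferentiable 𝓘(ℝ, E) 𝓘(ℝ, ℝ) f₁)
    (g : M → ℝ) (y : M) :
    Ω.poissonBracket (f + f₁) g y = Ω.poissonBracket f g y + Ω.poissonBracket f₁ g y :=
  Ω.poissonBracket_eq_of_hasMFDerivAt ((hf y).hasMFDerivAt.add (hf₁ y).hasMFDerivAt) g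

theorem SymplecticForm.poissonBracket_const_smul_left {f : M → ℝ} (c : ℝ)
    (hf : MDifferentiable 𝓘(ℝ, E) 𝓘(ℝ, ℝ) f) (g : M → ℝ) (y : M) :
    Ω.poissonBracket (c • f) g y = c * Ω.poissonBracket f g y :=
  Ω.poissonBracket_eq_of_hasMFDerivAt ((hf y).hasMFDerivAt.const_smul c) g

theorem SymplecticForm.poissonBracket_mul_left {f f₁ : M → ℝ}
    (hf : MDifferentiable 𝓘(ℝ, E) 𝓘(ℝ, ℝ) f) (hf₁ : MDifferentiable 𝓘(ℝ, E) 𝓘(ℝ, ℝ) f₁)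
    (g : M → ℝ) (y : M) :
    Ω.poissonBracket (f * f₁) g y =
      f y * Ω.poissonBracket f₁ g y + f₁ y * Ω.poissonBracket f g y :=
  Ω.poissonBracket_eq_of_hasMFDerivAt ((hf y).hasMFDerivAt.mul (hf₁ y).hasMFDerivAt) g

theorem SymplecticForm.poissonBracket_comp_left {f : M → ℝ} {φ : ℝ → ℝ} {φ' : ℝ} {y : M}
    (hf : MDifferentiable 𝓘(ℝ, E) 𝓘(ℝ, ℝ) f) (hφ : HasDerivAt φ φ' (f y)) (g : M → ℝ) :
    Ω.poissonBracket (φ ∘ f) g y = φ' * Ω.poissonBracket f g y := by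
  have := HasMFDerivAt.comp (I' := 𝓘(ℝ, ℝ)) y hφ.hasFDerivAt.hasMFDerivAt (hf y).hasMFDerivAt
  rw [Ω.poissonBracket_eq_of_hasMFDerivAt this g]
  exact (mul_comm _ _)

theorem SymplecticForm.poissonBracket_congr_left {f f₁ : M → ℝ} {y : M} (h : f =ᶠ[𝓝 y] f₁)
    (g : M → ℝ) : Ω.poissonBracket f g y = Ω.poissonBracket f₁ g y := by
  unfold SymplecticForm.poissonBracket
  rw [h.mfderiv_eq]
  rfl

theorem SymplecticForm.poissonBracket_const_left (c : ℝ) (g : M → ℝ) (y : M) :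
    Ω.poissonBracket (fun _ => c) g y = 0 :=
  Ω.poissonBracket_eq_of_hasMFDerivAt (hasMFDerivAt_const c y) g

/-- In a chart, the Hamiltonian vector field of a smooth function is a smooth vector field. -/
theorem SymplecticForm.exists_hamiltonianVectorField_inChart [IsManifold 𝓘(ℝ, E) ∞ M]
    {g : M → ℝ} (hg : ContMDiff 𝓘(ℝ, E) 𝓘(ℝ, ℝ) ∞ g) (p : M) :
    ∃ X : E → E, ContDiffOn ℝ ∞ X (extChartAt 𝓘(ℝ, E) p).target ∧
      ∀ f : M → ℝ, ContMDiff 𝓘(ℝ, E) 𝓘(ℝ, ℝ) ∞ f → ∀ u ∈ (extChartAt 𝓘(ℝ, E) p).target,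
        Ω.poissonBracket f g ((extChartAt 𝓘(ℝ, E) p).symm u) =
          fderiv ℝ (f ∘ (extChartAt 𝓘(ℝ, E) p).symm) u (X u) := by
  set e := extChartAt 𝓘(ℝ, E) p with he
  have ho : IsOpen e.target := isOpen_extChartAt_target p
  have hcd : ∀ f : M → ℝ, ContMDiff 𝓘(ℝ, E) 𝓘(ℝ, ℝ) ∞ f → ContDiffOn ℝ ∞ (f ∘ e.symm) e.target :=
    fun f hf => contMDiffOn_iff_contDiffOn.1
      (hf.comp_contMDiffOn (contMDiffOn_extChartAt_symm (I := 𝓘(ℝ, E)) p))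
  have hinv : ∀ u ∈ e.target, (mfderiv 𝓘(ℝ, E) 𝓘(ℝ, E) e.symm u).IsInvertible := fun u hu => by
    have := isInvertible_mfderivWithin_extChartAt_symm (I := 𝓘(ℝ, E)) hu
    rwa [show Set.range 𝓘(ℝ, E) = Set.univ by simp, mfderivWithin_univ] at this
  have hchain : ∀ f : M → ℝ, ContMDiff 𝓘(ℝ, E) 𝓘(ℝ, ℝ) ∞ f → ∀ u ∈ e.target, ∀ v : E,
      fderiv ℝ (f ∘ e.symm) u v =
        mfderiv 𝓘(ℝ, E) 𝓘(ℝ, ℝ) f (e.symm u) (mfderiv 𝓘(ℝ, E) 𝓘(ℝ, E) e.symm u v) := by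
    intro f hf u hu v
    have hs : MDifferentiableAt 𝓘(ℝ, E) 𝓘(ℝ, E) e.symm u := by
      have := mdifferentiableWithinAt_extChartAt_symm (I := 𝓘(ℝ, E)) hu
      rwa [show Set.range 𝓘(ℝ, E) = Set.univ by simp, mdifferentiableWithinAt_univ] at this
    have := mfderiv_comp u ((hf.mdifferentiable (by simp)) (e.symm u)) hs
    rw [mfderiv_eq_fderiv] at this
    rw [this]
    rfl
  -- Currying is continuous and linear in the form, so smoothness of the form in the chart passes to
  -- `L`.
  let J : (E [⋀^Fin 2]→L[ℝ] ℝ) →L[ℝ] E →L[ℝ] E →L[ℝ] ℝ :=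
    (ContinuousLinearMap.compL ℝ E (E [⋀^Fin 1]→L[ℝ] ℝ) (E →L[ℝ] ℝ)
      ((ContinuousAlternatingMap.ofSubsingletonLIE (𝕜 := ℝ) (E := E) (F := ℝ) (0 : Fin 1)).symm :
        (E [⋀^Fin 1]→L[ℝ] ℝ) →L[ℝ] (E →L[ℝ] ℝ))) ∘L
      ContinuousAlternatingMap.curryLeftLI.toContinuousLinearMap
  have hJ : ∀ (α : E [⋀^Fin 2]→L[ℝ] ℝ) (v w : E), J α v w = α ![v, w] := by
    intro α v w
    change α (Matrix.vecCons v fun _ => w) = _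
    congr 1
    funext i; fin_cases i <;> rfl
  let L : E → E →L[ℝ] E →L[ℝ] ℝ := fun u => J (Ω.form.inChart p u)
  have hLapp : ∀ u v w, L u v w = Ω.form (e.symm u)
      ![mfderiv 𝓘(ℝ, E) 𝓘(ℝ, E) e.symm u v, mfderiv 𝓘(ℝ, E) 𝓘(ℝ, E) e.symm u w] := by
    intro u v w
    change J (Ω.form.inChart p u) v w = _
    rw [hJ]
    change Ω.form (e.symm u) _ = _
    congr 1
    funext i; fin_cases i <;> rfl
  have hL : ContDiffOn ℝ ∞ L e.target := by
    have hJc : ContDiff ℝ ∞ fun α : E [⋀^Fin 2]→L[ℝ] ℝ => J α := by fun_prop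
    exact hJc.comp_contDiffOn (Ω.smooth p)
  have hLinv : ∀ u ∈ e.target, (L u).IsInvertible := by
    intro u hu
    obtain ⟨A, hA⟩ := hinv u hu
    have hinj : Function.Injective (L u : E →ₗ[ℝ] E →L[ℝ] ℝ) := by
      rw [injective_iff_map_eq_zero]
      intro v hv
      have h0 : mfderiv 𝓘(ℝ, E) 𝓘(ℝ, E) e.symm u v = 0 := by
        refine Ω.nondegenerate _ _ fun w => ?_
        obtain ⟨w', rfl⟩ := A.surjective w
        have h2 := hLapp u v w'
        rw [← hA] at h2 ⊢
        erw [← h2]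
        exact congrArg (fun l : E →L[ℝ] ℝ => l w') hv
      rw [← hA] at h0
      exact A.injective (h0.trans (map_zero A).symm)
    have hfin : Module.finrank ℝ E = Module.finrank ℝ (E →L[ℝ] ℝ) := by
      rw [← (LinearMap.toContinuousLinearMap (𝕜 := ℝ) (E := E) (F' := ℝ)).finrank_eq]
      exact (Subspace.dual_finrank_eq (K := ℝ) (V := E)).symm
    exact ⟨(LinearEquiv.ofInjectiveOfFinrankEq (L u : E →ₗ[ℝ] E →L[ℝ] ℝ) hinj
      hfin).toContinuousLinearEquiv, by ext; rfl⟩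
  have : CompleteSpace E := FiniteDimensional.complete ℝ E
  -- In the chart the defining equation reads `L u X = dg`; inversion of operators is smooth at
  -- invertible ones, so `X` is smooth.
  refine ⟨fun u => (L u).inverse (fderiv ℝ (g ∘ e.symm) u), ?_, ?_⟩
  · refine ContDiffOn.clm_apply (fun u hu => ?_)
      ((hcd g hg).fderiv_of_isOpen ho (by simp))
    exact (hLinv u hu).contDiffAt_map_inverse.comp_contDiffWithinAt u (hL u hu)
  · intro f hf u hu
    rw [hchain f hf u hu]
    unfold SymplecticForm.poissonBracket
    congr 1
    symm
    refine Ω.eq_hamiltonianVectorField fun w => ?_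
    obtain ⟨A, hA⟩ := hinv u hu
    obtain ⟨w', rfl⟩ := A.surjective w
    have h2 := hLapp u ((L u).inverse (fderiv ℝ (g ∘ e.symm) u)) w'
    have h3 := hchain g hg u hu w'
    rw [← hA] at h2 h3 ⊢
    refine h2.symm.trans (Eq.trans ?_ h3)
    obtain ⟨B, hB⟩ := hLinv u hu
    rw [← hB, ContinuousLinearMap.inverse_equiv]
    simp

theorem SymplecticForm.contMDiff_poissonBracket [IsManifold 𝓘(ℝ, E) ∞ M] {f g : M → ℝ}
    (hf : ContMDiff 𝓘(ℝ, E) 𝓘(ℝ, ℝ) ∞ f) (hg : ContMDiff 𝓘(ℝ, E) 𝓘(ℝ, ℝ) ∞ g) :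
    ContMDiff 𝓘(ℝ, E) 𝓘(ℝ, ℝ) ∞ (Ω.poissonBracket f g) := by
  intro p
  obtain ⟨X, hX, h⟩ := Ω.exists_hamiltonianVectorField_inChart hg p
  have ho := isOpen_extChartAt_target (I := 𝓘(ℝ, E)) p
  have hf' : ContDiffOn ℝ ∞ (f ∘ (extChartAt 𝓘(ℝ, E) p).symm) (extChartAt 𝓘(ℝ, E) p).target :=
    contMDiffOn_iff_contDiffOn.1
      (hf.comp_contMDiffOn (contMDiffOn_extChartAt_symm (I := 𝓘(ℝ, E)) p))
  have h1 : ContDiffAt ℝ ∞ (fun u => fderiv ℝ (f ∘ (extChartAt 𝓘(ℝ, E) p).symm) u (X u))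
      (extChartAt 𝓘(ℝ, E) p p) :=
    ((hf'.fderiv_of_isOpen ho (by simp)).clm_apply hX).contDiffAt
      (ho.mem_nhds (mem_extChartAt_target p))
  have h2 := h1.contMDiffAt.comp p (contMDiffAt_extChartAt (I := 𝓘(ℝ, E)) (x := p))
  refine h2.congr_of_eventuallyEq ?_
  filter_upwards [extChartAt_source_mem_nhds (I := 𝓘(ℝ, E)) p] with y hy
  have := h f hf _ ((extChartAt 𝓘(ℝ, E) p).map_source hy)
  rwa [(extChartAt 𝓘(ℝ, E) p).left_inv hy] at this

end Brackets

end SymplecticGeometry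

namespace SymplecticGeometry

/-! ### Second-order calculus at a maximum -/

section SecondOrder

variable {E : Type*} [NormedAddCommGroup E] [NormedSpace ℝ E]

/-- The second order Taylor expansion of a `C²` function on a normed space. -/
theorem isLittleO_second_order_taylor {f : E → ℝ} {p : E} (hf : ContDiffAt ℝ 2 f p) :
    (fun v => f (p + v) - f p - fderiv ℝ f p v - fderiv ℝ (fderiv ℝ f) p v v / 2)
      =o[𝓝 0] fun v => ‖v‖ ^ 2 := by
  have hsymm : IsSymmSndFDerivAt ℝ f p := hf.isSymmSndFDerivAt (by simp)
  have hd : HasFDerivAt (fderiv ℝ f) (fderiv ℝ (fderiv ℝ f) p) p :=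
    ((hf.fderiv_right (m := 1) (by norm_num)).differentiableAt (by norm_num)).hasFDerivAt
  set B := fderiv ℝ (fderiv ℝ f) p
  have h1 : ∀ᶠ v in 𝓝 (0 : E), DifferentiableAt ℝ f (p + v) := by
    have h : Filter.Tendsto (fun v : E => p + v) (𝓝 0) (𝓝 p) :=
      (Continuous.tendsto' (by fun_prop) _ _ (by simp))
    have h2 : ∀ᶠ u in 𝓝 p, DifferentiableAt ℝ f u :=
      (hf.eventually (by simp)).mono fun u hu => hu.differentiableAt (by norm_num)
    exact h.eventually h2
  refine Asymptotics.isLittleO_iff.2 fun c hc => ?_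
  have h2 := (hasFDerivAt_iff_isLittleO_nhds_zero.1 hd).def hc
  obtain ⟨r, hr, hball⟩ := Metric.eventually_nhds_iff_ball.1 (h1.and h2)
  refine Metric.eventually_nhds_iff_ball.2 ⟨r, hr, fun v hv => ?_⟩
  have hsub : ∀ w ∈ Metric.closedBall (0 : E) ‖v‖, w ∈ Metric.ball (0 : E) r := fun w hw => by
    simp only [mem_closedBall_zero_iff, mem_ball_zero_iff] at *
    exact hw.trans_lt hv
  -- By symmetry of `B` the remainder has as derivative the first-order remainder of `fderiv ℝ f`,
  -- of norm at most `c * ‖w‖`; the mean value inequality supplies the second factor `‖v‖`.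
  have hder : ∀ w ∈ Metric.closedBall (0 : E) ‖v‖,
      HasFDerivWithinAt (fun v => f (p + v) - f p - fderiv ℝ f p v - B v v / 2)
        (fderiv ℝ f (p + w) - fderiv ℝ f p - B w) (Metric.closedBall (0 : E) ‖v‖) w := by
    intro w hw
    have e1 : HasFDerivAt (fun v => f (p + v)) (fderiv ℝ f (p + w)) w :=
      (hasFDerivAt_comp_add_left p).2 (hball w (hsub w hw)).1.hasFDerivAt
    have e2 : HasFDerivAt (fun v => B v v / 2) (B w) w := by
      have := ((B.hasFDerivAt (x := w)).clm_apply (hasFDerivAt_id w)).mul_const (1 / 2 : ℝ)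
      simp only [id, ← div_eq_mul_one_div] at this
      refine this.congr_fderiv ?_
      ext z
      have : B z w = B w z := hsymm.eq z w
      simp [this]
      ring
    exact (((e1.sub_const _).sub (fderiv ℝ f p).hasFDerivAt).sub e2).hasFDerivWithinAt
  have hmv := (convex_closedBall (0 : E) ‖v‖).norm_image_sub_le_of_norm_hasFDerivWithin_le
    (C := c * ‖v‖) hder (fun w hw => (hball w (hsub w hw)).2.trans
      (mul_le_mul_of_nonneg_left (mem_closedBall_zero_iff.1 hw) hc.le))
    (x := 0) (y := v) (by simp) (by simp)
  simp only [add_zero, sub_self, map_zero, sub_zero, zero_div] at hmv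
  rw [Real.norm_of_nonneg (by positivity : (0 : ℝ) ≤ ‖v‖ ^ 2)]
  linarith [hmv, (by ring : c * ‖v‖ * ‖v‖ = c * ‖v‖ ^ 2)]

/-- If the value `q` were positive, then along `t • w` the gain `t² q / 2` would beat a Taylor error
of at most `t² q / 4`. -/
theorem fderiv_fderiv_nonpos_of_isLocalMax {f : E → ℝ} {p : E} (hf : ContDiffAt ℝ 2 f p)
    (hmax : IsLocalMax f p) (w : E) : fderiv ℝ (fderiv ℝ f) p w w ≤ 0 := by
  by_contra! hq
  have hw : w ≠ 0 := by rintro rfl; simp at hq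
  have hw' : 0 < ‖w‖ := norm_pos_iff.2 hw
  set q := fderiv ℝ (fderiv ℝ f) p w w
  have h1 := (isLittleO_second_order_taylor hf).def (show 0 < q / (4 * ‖w‖ ^ 2) by positivity)
  have ht : Filter.Tendsto (fun t : ℝ => t • w) (𝓝[≠] 0) (𝓝 0) :=
    (Continuous.tendsto' (by fun_prop) _ _ (by simp)).mono_left nhdsWithin_le_nhds
  have ht' : Filter.Tendsto (fun t : ℝ => p + t • w) (𝓝[≠] 0) (𝓝 p) := by
    simpa using ht.const_add p
  obtain ⟨t, ⟨h2, h3⟩, ht0⟩ :=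
    ((ht.eventually h1).and (ht'.eventually hmax)).and self_mem_nhdsWithin |>.exists
  have ht2 : 0 < t ^ 2 := by have : t ≠ 0 := ht0; positivity
  have e : q / (4 * ‖w‖ ^ 2) * ‖‖t • w‖ ^ 2‖ = t ^ 2 * q / 4 := by
    rw [Real.norm_of_nonneg (by positivity), norm_smul, mul_pow, Real.norm_eq_abs, sq_abs]
    field_simp
  rw [e, hmax.fderiv_eq_zero] at h2
  simp only [map_smul, smul_apply, smul_eq_mul,
    zero_apply] at h2
  have h4 := (abs_le.1 h2).1
  have h5 : t * (t * fderiv ℝ (fderiv ℝ f) p w w) = t ^ 2 * q := by ring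
  rw [h5] at h4
  have : 0 < t ^ 2 * q := mul_pos ht2 hq
  linarith

theorem exists_pos_mul_sq_norm_le [FiniteDimensional ℝ E] (Q : E →L[ℝ] E →L[ℝ] ℝ)
    (hQ : ∀ v, v ≠ 0 → 0 < Q v v) : ∃ m : ℝ, 0 < m ∧ ∀ v, m * ‖v‖ ^ 2 ≤ Q v v := by
  have : ProperSpace E := FiniteDimensional.proper ℝ E
  rcases subsingleton_or_nontrivial E with hE | hE
  · exact ⟨1, one_pos, fun v => by simp [Subsingleton.elim v 0]⟩
  obtain ⟨z, hz, hmin⟩ := (isCompact_sphere (0 : E) 1).exists_isMinOn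
    (NormedSpace.sphere_nonempty.2 zero_le_one)
    (f := fun v => Q v v) (by fun_prop)
  have hz0 : z ≠ 0 := ne_zero_of_mem_unit_sphere ⟨z, hz⟩
  refine ⟨Q z z, hQ z hz0, fun v => ?_⟩
  rcases eq_or_ne v 0 with rfl | hv
  · simp
  have hv' : ‖v‖ ≠ 0 := norm_ne_zero_iff.2 hv
  have h := hmin (show ‖v‖⁻¹ • v ∈ Metric.sphere (0 : E) 1 by
    simp [norm_smul, hv'])
  simp only [Set.mem_ofPred_eq, map_smul, smul_apply, smul_eq_mul] at h
  calc Q z z * ‖v‖ ^ 2 ≤ ‖v‖⁻¹ * (‖v‖⁻¹ * Q v v) * ‖v‖ ^ 2 := by gcongr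
    _ = Q v v := by field_simp

/-- A quadratic lower bound for `h p - h u` near a critical point with negative definite Hessian,
in terms of the square of a function vanishing at `p`. -/
theorem eventually_mul_sq_le_of_neg_definite [FiniteDimensional ℝ E] {h t : E → ℝ} {p : E}
    (hh : ContDiffAt ℝ 2 h p) (hcrit : fderiv ℝ h p = 0)
    (hneg : ∀ v, v ≠ 0 → fderiv ℝ (fderiv ℝ h) p v v < 0)
    {l : E →L[ℝ] ℝ} (ht : HasFDerivAt t l p) (htp : t p = 0) {c θ : ℝ} (hθ₀ : 0 ≤ θ) (hθ : θ < 1)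
    (hl : ∀ v, c * l v ^ 2 ≤ -fderiv ℝ (fderiv ℝ h) p v v) :
    ∀ᶠ u in 𝓝 p, θ * c / 2 * t u ^ 2 ≤ h p - h u := by
  set B := fderiv ℝ (fderiv ℝ h) p with hB
  obtain ⟨m, hm, hmB⟩ := exists_pos_mul_sq_norm_le (-B) (by simpa using hneg)
  have h1 := isLittleO_second_order_taylor hh
  rw [hcrit, ← hB] at h1
  have h2 := hasFDerivAt_iff_isLittleO_nhds_zero.1 ht
  have h3 : (fun v => l v) =O[𝓝 0] fun v : E => v := l.isBigO_id _
  -- This product is `t² - l²`, so `t²` may be replaced by `l²` up to `o(‖v‖²)`.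
  have h4 : (fun v => (t (p + v) - t p - l v) * (t (p + v) - t p - l v + 2 * l v))
      =o[𝓝 0] fun v : E => ‖v‖ * ‖v‖ :=
    h2.norm_right.mul_isBigO ((h2.isBigO.add (h3.const_mul_left 2)).norm_right)
  have h5 := h1.add ((h4.const_mul_left (θ * c / 2)).congr_right fun v => (sq ‖v‖).symm)
  -- Split `-B` as `θ(-B) + (1 - θ)(-B)`: the first part dominates `θ * c * l²`, the second, at
  -- least `(1 - θ) * m * ‖v‖²`, absorbs all `o(‖v‖²)` errors.
  have h6 := h5.def (show 0 < (1 - θ) * m / 2 by have := sub_pos.2 hθ; positivity)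
  have hT : Filter.Tendsto (fun u : E => u - p) (𝓝 p) (𝓝 0) :=
    Continuous.tendsto' (by fun_prop) _ _ (by simp)
  filter_upwards [hT.eventually h6] with u hu
  rw [Real.norm_of_nonneg (by positivity : (0 : ℝ) ≤ ‖u - p‖ ^ 2), add_sub_cancel, htp] at hu
  have h7 := (abs_le.1 hu).2
  simp only [zero_apply, sub_zero] at h7
  have h8 := hl (u - p)
  have h9 := hmB (u - p)
  simp only [neg_apply] at h9
  set v := u - p
  have h10 : θ * (c * l v ^ 2) ≤ θ * (-B v v) := mul_le_mul_of_nonneg_left h8 hθ₀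
  have h11 : (1 - θ) * (m * ‖v‖ ^ 2) ≤ (1 - θ) * (-B v v) :=
    mul_le_mul_of_nonneg_left h9 (sub_pos.2 hθ).le
  linarith [(by ring : θ * c / 2 * ((t u - l v) * (t u - l v + 2 * l v)) =
    θ * c / 2 * t u ^ 2 - θ * (c * l v ^ 2) / 2)]

end SecondOrder

end SymplecticGeometry

namespace SymplecticGeometry

/-! ### Smooth functions read in a chart -/

section Charts

variable {E : Type*} [NormedAddCommGroup E] [NormedSpace ℝ E]
  {M : Type*} [TopologicalSpace M] [ChartedSpace E M]

theorem contDiffAt_comp_extChartAt_symm [IsManifold 𝓘(ℝ, E) ∞ M] {h : M → ℝ}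
    (hh : ContMDiff 𝓘(ℝ, E) 𝓘(ℝ, ℝ) ∞ h) (x : M) : ContDiffAt ℝ ∞ (h ∘ (extChartAt 𝓘(ℝ, E) x).symm) (extChartAt 𝓘(ℝ, E) x x) :=
  (contMDiffOn_iff_contDiffOn.1
    (hh.comp_contMDiffOn (contMDiffOn_extChartAt_symm (I := 𝓘(ℝ, E)) x))).contDiffAt
      ((isOpen_extChartAt_target x).mem_nhds (mem_extChartAt_target x))

theorem isLocalMax_comp_extChartAt_symm {h : M → ℝ} {x : M} (hmax : IsLocalMax h x) :
    IsLocalMax (h ∘ (extChartAt 𝓘(ℝ, E) x).symm) (extChartAt 𝓘(ℝ, E) x x) := by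
  have hc := continuousAt_extChartAt_symm (I := 𝓘(ℝ, E)) x
  have hinv : (extChartAt 𝓘(ℝ, E) x).symm (extChartAt 𝓘(ℝ, E) x x) = x := extChartAt_to_inv x
  have := hc.tendsto
  rw [hinv] at this
  filter_upwards [this.eventually hmax] with u hu
  simpa [hinv] using hu

end Charts

/-! ### Hessian estimates for brackets and the perturbation -/

section Perturbation

variable {E : Type*} [NormedAddCommGroup E] [NormedSpace ℝ E] [FiniteDimensional ℝ E]
  {M : Type*} [TopologicalSpace M] [ChartedSpace E M] [IsManifold 𝓘(ℝ, E) ∞ M]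
  (Ω : SymplecticForm E M)

/-- At a critical point `x` of `h`, the bracket `{h, k}` vanishes, and its derivative and
`{{h, k}, k}` are given by the Hessian of `h`. -/
theorem SymplecticForm.exists_hessian_eq_poissonBracket {h k : M → ℝ}
    (hh : ContMDiff 𝓘(ℝ, E) 𝓘(ℝ, ℝ) ∞ h) (hk : ContMDiff 𝓘(ℝ, E) 𝓘(ℝ, ℝ) ∞ k) {x : M}
    (hcrit : fderiv ℝ (h ∘ (extChartAt 𝓘(ℝ, E) x).symm) (extChartAt 𝓘(ℝ, E) x x) = 0) :
    Ω.poissonBracket h k x = 0 ∧ ∃ w : E,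
      HasFDerivAt (Ω.poissonBracket h k ∘ (extChartAt 𝓘(ℝ, E) x).symm)
        ((fderiv ℝ (fderiv ℝ (h ∘ (extChartAt 𝓘(ℝ, E) x).symm))
          (extChartAt 𝓘(ℝ, E) x x)).flip w) (extChartAt 𝓘(ℝ, E) x x) ∧
      Ω.poissonBracket (Ω.poissonBracket h k) k x =
        fderiv ℝ (fderiv ℝ (h ∘ (extChartAt 𝓘(ℝ, E) x).symm)) (extChartAt 𝓘(ℝ, E) x x) w w := by
  obtain ⟨X, hX, hbr⟩ := Ω.exists_hamiltonianVectorField_inChart hk x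
  have hp := mem_extChartAt_target (I := 𝓘(ℝ, E)) x
  have hn := (isOpen_extChartAt_target (I := 𝓘(ℝ, E)) x).mem_nhds hp
  have hinv : (extChartAt 𝓘(ℝ, E) x).symm (extChartAt 𝓘(ℝ, E) x x) = x := extChartAt_to_inv x
  have hhx := contDiffAt_comp_extChartAt_symm hh x
  set e := extChartAt 𝓘(ℝ, E) x
  have hd : HasFDerivAt (fderiv ℝ (h ∘ e.symm)) (fderiv ℝ (fderiv ℝ (h ∘ e.symm)) (e x)) (e x) :=
    ((hhx.fderiv_right (m := 1) (by norm_cast)).differentiableAt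
      (by norm_num)).hasFDerivAt
  have hXd : HasFDerivAt X (fderiv ℝ X (e x)) (e x) :=
    ((hX.contDiffAt hn).differentiableAt (by simp)).hasFDerivAt
  have hD : HasFDerivAt (Ω.poissonBracket h k ∘ e.symm)
      ((fderiv ℝ (fderiv ℝ (h ∘ e.symm)) (e x)).flip (X (e x))) (e x) := by
    -- Differentiating `dh(X)`, the term with the derivative of `X` drops out because `dh` vanishes
    -- here.
    have h1 := hd.clm_apply hXd
    rw [hcrit, ContinuousLinearMap.zero_comp, zero_add] at h1
    refine h1.congr_of_eventuallyEq ?_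
    filter_upwards [hn] with u hu using hbr h hh u hu
  refine ⟨?_, X (e x), hD, ?_⟩
  · have := hbr h hh _ hp
    rwa [hinv, hcrit] at this
  · have := hbr _ (Ω.contMDiff_poissonBracket hh hk) _ hp
    rwa [hinv, hD.fderiv] at this

theorem SymplecticForm.poissonBracket_poissonBracket_nonpos {h k : M → ℝ}
    (hh : ContMDiff 𝓘(ℝ, E) 𝓘(ℝ, ℝ) ∞ h) (hk : ContMDiff 𝓘(ℝ, E) 𝓘(ℝ, ℝ) ∞ k) {x : M}
    (hmax : IsLocalMax h x) : Ω.poissonBracket (Ω.poissonBracket h k) k x ≤ 0 := by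
  have hm := isLocalMax_comp_extChartAt_symm (E := E) hmax
  obtain ⟨-, w, -, hw⟩ := Ω.exists_hessian_eq_poissonBracket hh hk hm.fderiv_eq_zero
  rw [hw]
  exact fderiv_fderiv_nonpos_of_isLocalMax
    ((contDiffAt_comp_extChartAt_symm hh x).of_le ENat.LEInfty.out) hm w

/-- Near a non-degenerate local maximum `x` of `h`, the defect `h x - h y` controls the square of
`{h, k}`. -/
theorem SymplecticForm.eventually_sq_poissonBracket_le {h k : M → ℝ}
    (hh : ContMDiff 𝓘(ℝ, E) 𝓘(ℝ, ℝ) ∞ h) (hk : ContMDiff 𝓘(ℝ, E) 𝓘(ℝ, ℝ) ∞ k) {x : M}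
    (hmax : IsLocalMax h x) (hx : IsNondegenerateCriticalPoint E h x)
    {θ : ℝ} (hθ₀ : 0 ≤ θ) (hθ : θ < 1)
    (ha : Ω.poissonBracket (Ω.poissonBracket h k) k x < 0) :
    ∀ᶠ y in 𝓝 x, θ / (2 * -Ω.poissonBracket (Ω.poissonBracket h k) k x) *
      Ω.poissonBracket h k y ^ 2 ≤ h x - h y := by
  have hm := isLocalMax_comp_extChartAt_symm (E := E) hmax
  obtain ⟨h0, w, hD, hw⟩ := Ω.exists_hessian_eq_poissonBracket hh hk hx.1
  have hC : ContDiffAt ℝ 2 (h ∘ (extChartAt 𝓘(ℝ, E) x).symm) (extChartAt 𝓘(ℝ, E) x x) :=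
    (contDiffAt_comp_extChartAt_symm hh x).of_le ENat.LEInfty.out
  have hnp := fderiv_fderiv_nonpos_of_isLocalMax hC hm
  have hsymm : IsSymmSndFDerivAt ℝ (h ∘ (extChartAt 𝓘(ℝ, E) x).symm) (extChartAt 𝓘(ℝ, E) x x) :=
    hC.isSymmSndFDerivAt (by simp)
  have hnd := hx.2
  have hinv : (extChartAt 𝓘(ℝ, E) x).symm (extChartAt 𝓘(ℝ, E) x x) = x := extChartAt_to_inv x
  rw [hw] at ha ⊢
  -- Cauchy–Schwarz for the positive semidefinite form `-B`. It also makes `-B` definite: `B v v =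
  -- 0` puts `v` in the kernel, which is trivial by non-degeneracy.
  have hCS : ∀ v z : E, fderiv ℝ (fderiv ℝ (h ∘ (extChartAt 𝓘(ℝ, E) x).symm))
        (extChartAt 𝓘(ℝ, E) x x) v z ^ 2 ≤
      fderiv ℝ (fderiv ℝ (h ∘ (extChartAt 𝓘(ℝ, E) x).symm)) (extChartAt 𝓘(ℝ, E) x x) v v *
      fderiv ℝ (fderiv ℝ (h ∘ (extChartAt 𝓘(ℝ, E) x).symm)) (extChartAt 𝓘(ℝ, E) x x) z z := by
    intro v z
    have := LinearMap.BilinForm.apply_mul_apply_le_of_forall_zero_le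
      (-((fderiv ℝ (fderiv ℝ (h ∘ (extChartAt 𝓘(ℝ, E) x).symm))
        (extChartAt 𝓘(ℝ, E) x x)).toLinearMap₁₂)) (fun v => by simpa using hnp v) v z
    rw [LinearMap.neg_apply, LinearMap.neg_apply, LinearMap.neg_apply, LinearMap.neg_apply,
      LinearMap.neg_apply, LinearMap.neg_apply, neg_mul_neg, neg_mul_neg] at this
    refine Eq.trans_le ?_ this
    rw [sq]
    exact congrArg _ (hsymm.eq v z)
  set B := fderiv ℝ (fderiv ℝ (h ∘ (extChartAt 𝓘(ℝ, E) x).symm)) (extChartAt 𝓘(ℝ, E) x x)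
  have hev := eventually_mul_sq_le_of_neg_definite (c := 1 / -B w w) hC hx.1
    (fun v hv => lt_of_le_of_ne (hnp v) fun h0 => hv <| hnd v fun z => by
      have := hCS v z
      rw [h0, zero_mul] at this
      exact pow_eq_zero_iff two_ne_zero |>.1 (le_antisymm this (sq_nonneg _)))
    hD (by simpa [hinv] using h0) hθ₀ hθ (fun v => by
      have h1 : 0 < -B w w := neg_pos.2 ha
      rw [one_div_mul_eq_div, div_le_iff₀ h1]
      rw [neg_mul_neg]
      exact hCS v w)
  filter_upwards [(continuousAt_extChartAt (I := 𝓘(ℝ, E)) x).eventually hev,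
    extChartAt_source_mem_nhds (I := 𝓘(ℝ, E)) x] with y hy hys
  simp only [Function.comp_apply, (extChartAt 𝓘(ℝ, E) x).left_inv hys, hinv] at hy
  convert hy using 2
  field_simp

/-- Lowering a non-degenerate strict maximum of `h` over `U` by a `C⁰`-small perturbation
`{u, k}`. -/
theorem SymplecticForm.exists_perturbation [T2Space M] {h k : M → ℝ}
    (hh : ContMDiff 𝓘(ℝ, E) 𝓘(ℝ, ℝ) ∞ h) (hk : ContMDiff 𝓘(ℝ, E) 𝓘(ℝ, ℝ) ∞ k) {x : M}
    (hx : IsNondegenerateCriticalPoint E h x) {U : Set M} (hU : U ∈ 𝓝 x)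
    (hUc : IsCompact (closure U)) (hmax : ∀ y ∈ closure U, y ≠ x → h y < h x)
    {a : ℝ} (ha : 0 < a) (hax : Ω.poissonBracket (Ω.poissonBracket h k) k x = -a) :
    ∃ V : Set M, IsOpen V ∧ x ∈ V ∧ closure V ⊆ U ∧
      ∀ᶠ s in 𝓝[>] (0 : ℝ), ∃ u : M → ℝ, ContMDiff 𝓘(ℝ, E) 𝓘(ℝ, ℝ) ∞ u ∧
        (∀ y, |u y| ≤ a * s ^ 3) ∧ (∀ y ∉ V, u y = 0) ∧
        ∀ y ∈ U, h y + Ω.poissonBracket u k y ≤ h x - a * s ^ 2 / 2 := by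
  have hτ := Ω.contMDiff_poissonBracket hh hk
  set τ := Ω.poissonBracket h k with hτdef
  have hτk := Ω.contMDiff_poissonBracket hτ hk
  have hloc : IsLocalMax h x := by
    filter_upwards [hU] with y hy
    rcases eq_or_ne y x with rfl | hne
    · exact le_rfl
    · exact (hmax y (subset_closure hy) hne).le
  -- The losses `θ = 7/8` here and `a / 4` in `hclose` are chosen so that exactly the factor `1/2`
  -- remains at the end.
  have hest : ∀ᶠ y in 𝓝 x, 7 / 8 / (2 * a) * τ y ^ 2 ≤ h x - h y := by
    have := Ω.eventually_sq_poissonBracket_le hh hk hloc hx (θ := 7 / 8) (by norm_num)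
      (by norm_num) (by rw [← hτdef, hax]; linarith)
    rwa [← hτdef, hax, neg_neg] at this
  have hclose : ∀ᶠ y in 𝓝 x, |Ω.poissonBracket τ k y + a| < a / 4 := by
    have hc : Continuous fun y => |Ω.poissonBracket τ k y + a| :=
      (hτk.continuous.add continuous_const).abs
    exact hc.continuousAt.eventually_lt continuousAt_const (by simp [hax, ha])
  obtain ⟨χ, hχU : tsupport χ ⊆ U⟩ : ∃ χ : SmoothBumpFunction 𝓘(ℝ, E) x, tsupport χ ⊆ U := by
    simpa using (SmoothBumpFunction.nhds_basis_tsupport (I := 𝓘(ℝ, E)) x).mem_iff.1 hU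
  have hχ : ContMDiff 𝓘(ℝ, E) 𝓘(ℝ, ℝ) ∞ χ := χ.contMDiff
  have hχk := Ω.contMDiff_poissonBracket hχ hk
  obtain ⟨W, hWsub, hWo, hxW⟩ := mem_nhds_iff.1
    (hest.and (hclose.and χ.eventuallyEq_one))
  -- Compactness of `closure U \ W` turns the strict maximum into a uniform gap.
  obtain ⟨δ, hδ, hδK⟩ : ∃ δ : ℝ, 0 < δ ∧ ∀ y ∈ closure U \ W, h y ≤ h x - δ := by
    rcases (closure U \ W).eq_empty_or_nonempty with hK | hK
    · exact ⟨1, one_pos, by simp [hK]⟩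
    · obtain ⟨z, hz, hzmax⟩ := (hUc.diff hWo).exists_isMaxOn hK hh.continuous.continuousOn
      refine ⟨h x - h z, sub_pos.2 (hmax z hz.1 ?_), fun y hy => ?_⟩
      · rintro rfl
        exact hz.2 hxW
      · rw [sub_sub_cancel]
        exact hzmax hy
  obtain ⟨C₁, hC₁⟩ := hUc.exists_bound_of_continuousOn hτk.continuous.continuousOn
  obtain ⟨C₂, hC₂⟩ := hUc.exists_bound_of_continuousOn hχk.continuous.continuousOn
  have hsmall : ∀ᶠ s in 𝓝[>] (0 : ℝ), a * s ^ 3 * C₂ + s ^ 2 * C₁ + a * s ^ 2 / 2 < δ := by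
    have hc : Continuous fun s : ℝ => a * s ^ 3 * C₂ + s ^ 2 * C₁ + a * s ^ 2 / 2 := by fun_prop
    exact nhdsWithin_le_nhds (hc.continuousAt.eventually_lt continuousAt_const (by simpa using hδ))
  refine ⟨Function.support χ, χ.isOpen_support, χ.c_mem_support, hχU, ?_⟩
  filter_upwards [hsmall, self_mem_nhdsWithin] with s hs hs0
  replace hs0 : 0 < s := hs0
  -- The amplitude `a s³` is the allowed size of `u`; the frequency `1/(a s)` makes `φ' = s²
  -- cos(r/(a s))`, on the same scale as the drop `τ²/(2a)` of `h`.
  set φ : ℝ → ℝ := fun r => a * s ^ 3 * Real.sin (r / (a * s))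
  have hφ : ContDiff ℝ ∞ φ := by
    exact contDiff_const.mul (Real.contDiff_sin.comp (contDiff_id.div_const _))
  have hφ' : ∀ r, HasDerivAt φ (s ^ 2 * Real.cos (r / (a * s))) r := fun r => by
    have := (((hasDerivAt_id r).div_const (a * s)).sin).const_mul (a * s ^ 3)
    refine this.congr_deriv ?_
    simp only [id]
    field_simp
  have hφτ : ContMDiff 𝓘(ℝ, E) 𝓘(ℝ, ℝ) ∞ (φ ∘ τ) := hφ.contMDiff.comp hτ
  have hφabs : ∀ r, |φ r| ≤ a * s ^ 3 := fun r => by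
    rw [abs_mul, abs_of_pos (by positivity : 0 < a * s ^ 3)]
    exact mul_le_of_le_one_right (by positivity) (Real.abs_sin_le_one _)
  have hbr : ∀ y, Ω.poissonBracket (χ * (φ ∘ τ)) k y =
      χ y * (s ^ 2 * Real.cos (τ y / (a * s)) * Ω.poissonBracket τ k y) +
        φ (τ y) * Ω.poissonBracket χ k y := fun y => by
    rw [Ω.poissonBracket_mul_left (hχ.mdifferentiable (by simp)) (hφτ.mdifferentiable (by simp)),
      Ω.poissonBracket_comp_left (hτ.mdifferentiable (by simp)) (hφ' (τ y))]
    rfl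
  refine ⟨χ * (φ ∘ τ), hχ.mul hφτ, fun y => ?_, fun y hy => ?_, fun y hy => ?_⟩
  · rw [Pi.mul_apply, abs_mul, abs_of_nonneg χ.nonneg]
    exact (mul_le_of_le_one_left (abs_nonneg _) χ.le_one).trans (hφabs _)
  · rw [Pi.mul_apply, Function.notMem_support.1 hy, zero_mul]
  · rw [hbr]
    by_cases hyW : y ∈ W
    · obtain ⟨h1, h2, -⟩ := hWsub hyW
      have h3 : χ =ᶠ[𝓝 y] fun _ => (1 : ℝ) := by
        filter_upwards [hWo.mem_nhds hyW] with z hz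
        exact (hWsub hz).2.2
      rw [h3.eq_of_nhds, Ω.poissonBracket_congr_left h3, Ω.poissonBracket_const_left]
      set t := τ y / (a * s) with ht
      have h4 : 7 / 8 / (2 * a) * τ y ^ 2 = 7 / 16 * (a * s ^ 2 * t ^ 2) := by
        rw [ht]; field_simp; ring
      have h5 : Real.cos t * Ω.poissonBracket τ k y ≤ -(a * Real.cos t) + a / 4 := by
        have h6 : Real.cos t * (Ω.poissonBracket τ k y + a) ≤ a / 4 := by
          refine (le_abs_self _).trans ?_
          rw [abs_mul]
          exact (mul_le_of_le_one_left (abs_nonneg _) (Real.abs_cos_le_one t)).trans h2.le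
        linarith
      -- Write the right side as `7/8 (t²/2 + cos t) + (cos t)/8`, which is at least `7/8 - 1/8`.
      have h6 : 3 / 4 ≤ 7 / 16 * t ^ 2 + Real.cos t := by
        linarith [Real.one_sub_sq_div_two_le_cos (x := t), Real.neg_one_le_cos t]
      have h7 : a * s ^ 2 * (3 / 4) ≤ a * s ^ 2 * (7 / 16 * t ^ 2 + Real.cos t) :=
        mul_le_mul_of_nonneg_left h6 (by positivity)
      have h8 := mul_le_mul_of_nonneg_left h5 (sq_nonneg s)
      rw [h4] at h1
      linarith
    -- Off `W` the cutoff may vary, but `{u,k}` is `O(s²)` on `closure U`, and `hsmall` keeps it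
    -- below the gap `δ`.
    · have hyU := subset_closure hy
      have h1 := hδK y ⟨hyU, hyW⟩
      have h2 : φ (τ y) * Ω.poissonBracket χ k y ≤ a * s ^ 3 * C₂ := by
        refine (le_abs_self _).trans ?_
        rw [abs_mul]
        exact mul_le_mul (hφabs _) (hC₂ y hyU) (abs_nonneg _) (by positivity)
      have h3 : χ y * (s ^ 2 * Real.cos (τ y / (a * s)) * Ω.poissonBracket τ k y) ≤
          s ^ 2 * C₁ := by
        refine (le_abs_self _).trans ?_
        rw [abs_mul, abs_mul, abs_mul, abs_of_nonneg χ.nonneg, abs_of_nonneg (sq_nonneg s)]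
        refine (mul_le_of_le_one_left (by positivity) χ.le_one).trans ?_
        rw [mul_assoc]
        refine mul_le_mul_of_nonneg_left ?_ (sq_nonneg s)
        exact (mul_le_of_le_one_left (abs_nonneg _) (Real.abs_cos_le_one _)).trans (hC₁ y hyU)
      linarith

end Perturbation

end SymplecticGeometry

/-! ### From the parameter `s` to `ε`, and the theorem -/

namespace SymplecticGeometry

/-- With `c³ = a` and `ε = a s³` one has `ε^(2/3) = (c s)²`, and `b^(1/3) ≤ 3c/2` because `2 ≤
(3/2)³`; this is where the constant `1/3` comes from. -/
theorem third_mul_rpow_le {a b s : ℝ} (ha : 0 < a) (hs : 0 < s) (hb : 0 ≤ b) (hba : b ≤ 2 * a) :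
    (1 / 3 : ℝ) * b ^ (1 / 3 : ℝ) * (a * s ^ 3) ^ (2 / 3 : ℝ) ≤ a * s ^ 2 / 2 := by
  obtain ⟨c, hc, rfl⟩ : ∃ c : ℝ, 0 < c ∧ c ^ 3 = a :=
    ⟨a ^ (1 / 3 : ℝ), by positivity, by rw [← Real.rpow_natCast, ← Real.rpow_mul ha.le]; norm_num⟩
  have h1 : b ^ (1 / 3 : ℝ) ≤ 3 / 2 * c := by
    calc b ^ (1 / 3 : ℝ) ≤ ((3 / 2 * c) ^ 3) ^ (1 / 3 : ℝ) := by
          refine Real.rpow_le_rpow hb (hba.trans ?_) (by norm_num)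
          rw [mul_pow]
          gcongr
          norm_num
      _ = 3 / 2 * c := by
          rw [← Real.rpow_natCast, ← Real.rpow_mul (by positivity)]
          norm_num
  have h2 : (c ^ 3 * s ^ 3) ^ (2 / 3 : ℝ) = (c * s) ^ 2 := by
    rw [← mul_pow, ← Real.rpow_natCast, ← Real.rpow_mul (by positivity), ← Real.rpow_natCast]
    norm_num
  rw [h2]
  calc 1 / 3 * b ^ (1 / 3 : ℝ) * (c * s) ^ 2 ≤ 1 / 3 * (3 / 2 * c) * (c * s) ^ 2 := by gcongr
    _ = c ^ 3 * s ^ 2 / 2 := by ring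

variable {E : Type*} [NormedAddCommGroup E] [NormedSpace ℝ E] [FiniteDimensional ℝ E]
  {M : Type*} [TopologicalSpace M] [T2Space M] [ChartedSpace E M] [IsManifold 𝓘(ℝ, E) ∞ M]

theorem SymplecticForm.exists_perturbation_rpow (Ω : SymplecticForm E M) {h k : M → ℝ}
    (hh : ContMDiff 𝓘(ℝ, E) 𝓘(ℝ, ℝ) ∞ h) (hk : ContMDiff 𝓘(ℝ, E) 𝓘(ℝ, ℝ) ∞ k) {x : M}
    (hx : IsNondegenerateCriticalPoint E h x) {U : Set M} (hU : U ∈ 𝓝 x)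
    (hUc : IsCompact (closure U)) (hmax : ∀ y ∈ closure U, y ≠ x → h y < h x)
    {b : ℝ} (hb : 0 < b) (hbx : b ≤ 2 * -Ω.poissonBracket (Ω.poissonBracket h k) k x) :
    ∃ V : Set M, IsOpen V ∧ x ∈ V ∧ closure V ⊆ U ∧
      ∃ ε₀ : ℝ, 0 < ε₀ ∧ ∀ ε : ℝ, 0 < ε → ε < ε₀ →
        ∃ u : M → ℝ, ContMDiff 𝓘(ℝ, E) 𝓘(ℝ, ℝ) ∞ u ∧
          (∀ y, |u y| ≤ ε) ∧ (∀ y ∉ V, u y = 0) ∧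
          ∀ y ∈ U, h y + Ω.poissonBracket u k y ≤
            h x - (1 / 3 : ℝ) * b ^ (1 / 3 : ℝ) * ε ^ (2 / 3 : ℝ) := by
  obtain ⟨a, ha⟩ : ∃ a, a = -Ω.poissonBracket (Ω.poissonBracket h k) k x := ⟨_, rfl⟩
  rw [← ha] at hbx
  have ha0 : 0 < a := by linarith
  obtain ⟨V, hV, hxV, hVU, hs⟩ := Ω.exists_perturbation hh hk hx hU hUc hmax ha0
    (by rw [ha, neg_neg])
  obtain ⟨s₀, hs₀, hs⟩ := mem_nhdsGT_iff_exists_Ioo_subset.1 hs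
  replace hs₀ : 0 < s₀ := hs₀
  refine ⟨V, hV, hxV, hVU, a * s₀ ^ 3, by positivity, fun ε hε hεs => ?_⟩
  obtain ⟨s, hs0, rfl⟩ : ∃ s : ℝ, 0 < s ∧ a * s ^ 3 = ε :=
    ⟨(ε / a) ^ (1 / 3 : ℝ), by positivity, by
      rw [← Real.rpow_natCast, ← Real.rpow_mul (by positivity)]
      norm_num
      field_simp⟩
  have hss : s < s₀ := lt_of_pow_lt_pow_left₀ 3 hs₀.le (lt_of_mul_lt_mul_left hεs ha0.le)
  obtain ⟨u, hu, hua, huV, huU⟩ := hs ⟨hs0, hss⟩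
  exact ⟨u, hu, hua, huV, fun y hy => (huU y hy).trans
    (sub_le_sub_left (third_mul_rpow_le ha0 hs0 hb.le hbx) _)⟩

end SymplecticGeometry

theorem theorem1p1p6
    {E : Type*} [NormedAddCommGroup E] [NormedSpace ℝ E] [FiniteDimensional ℝ E]
    {M : Type*} [TopologicalSpace M] [T2Space M] [ChartedSpace E M] [IsManifold 𝓘(ℝ, E) ∞ M]
    (Ω : SymplecticGeometry.SymplecticForm E M)
    (f g : M → ℝ) (hf : ContMDiff 𝓘(ℝ, E) 𝓘(ℝ, ℝ) ∞ f) (hg : ContMDiff 𝓘(ℝ, E) 𝓘(ℝ, ℝ) ∞ g)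
    (x : M)
    (hx : SymplecticGeometry.IsNondegenerateCriticalPoint E (Ω.poissonBracket f g) x)
    (U : Set M) (hU : U ∈ 𝓝 x) (hUc : IsCompact (closure U))
    (hmax : ∀ y ∈ closure U, y ≠ x → Ω.poissonBracket f g y < Ω.poissonBracket f g x) :
    0 ≤ Ω.Phi f g x ∧
    ∃ V : Set M, IsOpen V ∧ x ∈ V ∧ closure V ⊆ U ∧
      ∃ ε₀ : ℝ, 0 < ε₀ ∧ ∀ ε : ℝ, 0 < ε → ε < ε₀ →
        ∃ F G : M → ℝ, ContMDiff 𝓘(ℝ, E) 𝓘(ℝ, ℝ) ∞ F ∧ ContMDiff 𝓘(ℝ, E) 𝓘(ℝ, ℝ) ∞ G ∧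
          (∀ y, |F y - f y| ≤ ε) ∧ (∀ y, |G y - g y| ≤ ε) ∧
          (∀ y ∈ U, Ω.poissonBracket F G y ≤
            Ω.poissonBracket f g x
              - (1 / 3 : ℝ) * Ω.Phi f g x ^ (1 / 3 : ℝ) * ε ^ (2 / 3 : ℝ)) ∧
          (∀ y ∉ V, F y = f y ∧ G y = g y) ∧
          (Ω.poissonBracket (Ω.poissonBracket (Ω.poissonBracket f g) g) g x ≤
              Ω.poissonBracket (Ω.poissonBracket (Ω.poissonBracket f g) f) f x → G = g) ∧
          (Ω.poissonBracket (Ω.poissonBracket (Ω.poissonBracket f g) f) f x <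
              Ω.poissonBracket (Ω.poissonBracket (Ω.poissonBracket f g) g) g x → F = f) := by
  have hh := Ω.contMDiff_poissonBracket hf hg
  have hloc : IsLocalMax (Ω.poissonBracket f g) x := by
    filter_upwards [hU] with y hy
    rcases eq_or_ne y x with rfl | hne
    · exact le_rfl
    · exact (hmax y (subset_closure hy) hne).le
  have hnf := Ω.poissonBracket_poissonBracket_nonpos hh hf hloc
  have hng := Ω.poissonBracket_poissonBracket_nonpos hh hg hloc
  have hΦ : Ω.Phi f g x = -Ω.poissonBracket (Ω.poissonBracket (Ω.poissonBracket f g) f) f x -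
    Ω.poissonBracket (Ω.poissonBracket (Ω.poissonBracket f g) g) g x := rfl
  have hΦ0 : 0 ≤ Ω.Phi f g x := by linarith
  refine ⟨hΦ0, ?_⟩
  -- If `Φ(x) = 0` no lowering is asked for, and the unperturbed pair works.
  rcases hΦ0.eq_or_lt with hΦz | hΦpos
  · obtain ⟨χ, hχ : tsupport χ ⊆ U⟩ : ∃ χ : SmoothBumpFunction 𝓘(ℝ, E) x, tsupport χ ⊆ U := by
      simpa using (SmoothBumpFunction.nhds_basis_tsupport (I := 𝓘(ℝ, E)) x).mem_iff.1 hU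
    refine ⟨Function.support χ, χ.isOpen_support, χ.c_mem_support, hχ, 1, one_pos,
      fun ε hε _ => ⟨f, g, hf, hg, by simp [hε.le], by simp [hε.le], fun y hy => ?_, by simp,
        fun _ => rfl, fun _ => rfl⟩⟩
    rw [← hΦz, Real.zero_rpow (by norm_num), mul_zero, zero_mul, sub_zero]
    rcases eq_or_ne y x with rfl | hne
    · exact le_rfl
    · exact (hmax y (subset_closure hy) hne).le
  -- Minus the smaller of the two triple brackets is at least `Φ(x) / 2`, as `hbx` demands.
  by_cases hle : Ω.poissonBracket (Ω.poissonBracket (Ω.poissonBracket f g) g) g x ≤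
      Ω.poissonBracket (Ω.poissonBracket (Ω.poissonBracket f g) f) f x
  · obtain ⟨V, hV, hxV, hVU, ε₀, hε₀, H⟩ := Ω.exists_perturbation_rpow hh hg hx hU hUc hmax hΦpos
      (by linarith)
    refine ⟨V, hV, hxV, hVU, ε₀, hε₀, fun ε hε hεε₀ => ?_⟩
    obtain ⟨u, hu, hua, huV, huU⟩ := H ε hε hεε₀
    refine ⟨f + u, g, hf.add hu, hg, by simpa using hua, by simp [hε.le], fun y hy => ?_,
      fun y hy => by simp [huV y hy], fun _ => rfl, fun hlt => absurd hle hlt.not_ge⟩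
    rw [Ω.poissonBracket_add_left (hf.mdifferentiable (by simp)) (hu.mdifferentiable (by simp))]
    exact huU y hy
  · obtain ⟨V, hV, hxV, hVU, ε₀, hε₀, H⟩ := Ω.exists_perturbation_rpow hh hf hx hU hUc hmax hΦpos
      (by linarith)
    refine ⟨V, hV, hxV, hVU, ε₀, hε₀, fun ε hε hεε₀ => ?_⟩
    obtain ⟨u, hu, hua, huV, huU⟩ := H ε hε hεε₀
    -- The minus sign compensates antisymmetry: `{f, g - u} = {f,g} + {u,f}`.
    refine ⟨f, g + (-1 : ℝ) • u, hf, hg.add ((contDiff_const_smul (-1 : ℝ)).contMDiff.comp hu), by simp [hε.le],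
      by simpa using hua, fun y hy => ?_, fun y hy => by simp [huV y hy],
      fun h => absurd h hle, fun _ => rfl⟩
    have hud := hu.mdifferentiable (n := ∞) (by simp)
    rw [Ω.poissonBracket_swap, Ω.poissonBracket_add_left (hg.mdifferentiable (by simp))
      (hud.const_smul (-1)), Ω.poissonBracket_const_smul_left _ hud,
      Ω.poissonBracket_swap g f]
    linarith [huU y hy]
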